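/- Let $(M,g)$ be a Riemannian manifold of dimension $2n+s$ with Levi-Civita connection $\nabla$, equipped with a framed metric $f$-structure $(f,\xi_i,\eta_i,g)_{1\le i\le s}$: $f$ is a $(1,1)$-tensor field of rank $2n$, $f^2=-I+\sum_i\eta_i\otimes\xi_i$, $\eta_i(\xi_j)=\delta_{ij}$, $f\xi_i=0$, $\eta_i\circ f=0$, $g(fX,fY)=g(X,Y)-\sum_i\eta_i(X)\eta_i(Y)$, $\eta_i(X)=g(X,\xi_i)$. Suppose that $M$ is a trans-$S$-manifold with smooth functions $\alpha_i,\beta_i$, i.e. the structure is normal, $[f,f]+2\sum_i d\eta_i\otimes\xi_i=0$ (where $2d\eta(X,Y)=X\eta(Y)-Y\eta(X)-\eta([X,Y])$), and $$(\nabla_Xf)Y=\sum_{i=1}^s\big[\alpha_i\{g(fX,fY)\xi_i+\eta_i(Y)f^2X\}+\beta_i\{g(fX,Y)\xi_i-\eta_i(Y)fX\}\big].$$ Let $\gamma:J\to M$ be a smooth unit-speed curve on an interval $J$ (with more than one point), $T=\gamma'$, which is Legendre ($\eta_i(T)=0$ for all $i$) and is a Frenet curve of osculating order $r\ge 4$: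 there are a smooth orthonormal frame $E_1=T,E_2,\dots,E_r$ along $\gamma$ and positive smooth functions $\kappa_1,\dots,\kappa_{r-1}$ with $\nabla_TE_j=-\kappa_{j-1}E_{j-1}+\kappa_jE_{j+1}$ (the terms with $\kappa_0$ and $\kappa_r$ being absent). The curve is called $C$-proper in the tangent bundle, with factor $\lambda$, if $\Delta H=\lambda\sum_{i=1}^s\xi_i$ along $\gamma$, where $H=\nabla_TT$, $\Delta V=-\nabla_T\nabla_TV$ and $\lambda:J\to\mathbb R$ is a differentiable function without zeros; it is called $C$-proper if this holds for some such $\lambda$. Theorem. Let $\lambda:J\to\mathbb R$ be differentiable and without zeros. Then $\gamma$ is $C$-proper in the tangent bundle with factor $\lambda$ if and only if there are smooth functions $w,\varphi:J\to\mathbb R$ such that along $\gamma$ $$\sum_{i=1}^s\xi_i=\sqrt s\,(\cos w\,E_2+\sin w\cos\varphi\,E_3+\sin w\sin\varphi\,E_4)$$ and the following six conditions hold: $\kappa_1$ is constant; $$\sum_{i=1}^s\beta_i=-\sqrt s\,\kappa_1\cos w;$$ $$\lambda\sqrt s\cos w=\kappa_1(\kappa_1^2+\kappa_2^2),\qquad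 \lambda\sqrt s\sin w\cos\varphi=-\kappa_1\kappa_2',\qquad \lambda\sqrt s\sin w\sin\varphi=-\kappa_1\kappa_2\kappa_3;$$ and, if $r\ge5$, $$\kappa_4=-\frac{\big(\sum_{i=1}^s\alpha_i\big)\,g(fT,E_5)}{\sqrt s\,\sin w\sin\varphi}$$ (for $r=4$ there are no $\kappa_4$ and $E_5$, and the last condition is void). In particular, $\gamma$ is $C$-proper in the tangent bundle if and only if such $\lambda,w,\varphi$ exist. -/

import Mathlib

open Bundle Set
open scoped Manifold ContDiff

noncomputable section

namespace TransS

section Connection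

variable {E : Type*} [NormedAddCommGroup E] [NormedSpace ℝ E]
  [FiniteDimensional ℝ E] {M : Type*} [TopologicalSpace M] [ChartedSpace E M]
  [IsManifold 𝓘(ℝ, E) ∞ M]

/-- A vector field on `M` that is smooth at `x`. -/
def SmoothFieldAt (X : ∀ x : M, TangentSpace 𝓘(ℝ, E) x) (x : M) : Prop :=
  ContMDiffAt 𝓘(ℝ, E) 𝓘(ℝ, E).tangent ∞ (fun y => (⟨y, X y⟩ : TangentBundle 𝓘(ℝ, E) M)) x

/-- The derivative `X(h)` at `x` of a function `h` in the direction of the vector field `X`. -/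
def dirDeriv (X : ∀ x : M, TangentSpace 𝓘(ℝ, E) x) (h : M → ℝ) (x : M) : ℝ :=
  (mfderiv 𝓘(ℝ, E) 𝓘(ℝ, ℝ) h x : TangentSpace 𝓘(ℝ, E) x →L[ℝ] ℝ) (X x)

/-- `nabla` is the Levi-Civita connection of the Riemannian metric of `M`: it is compatible with
the metric, `X g(Y, Z) = g(∇_X Y, Z) + g(Y, ∇_X Z)`, and has no torsion. -/
structure IsLeviCivita [RiemannianBundle (fun x : M => TangentSpace 𝓘(ℝ, E) x)]
    (nabla : CovariantDerivative 𝓘(ℝ, E) E (fun x : M => TangentSpace 𝓘(ℝ, E) x)) : Prop where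
  metric : ∀ (X Y Z : ∀ x : M, TangentSpace 𝓘(ℝ, E) x) (x : M),
    MDifferentiableAt 𝓘(ℝ, E) 𝓘(ℝ, E).tangent (fun y => (⟨y, Y y⟩ : TangentBundle 𝓘(ℝ, E) M)) x →
    MDifferentiableAt 𝓘(ℝ, E) 𝓘(ℝ, E).tangent (fun y => (⟨y, Z y⟩ : TangentBundle 𝓘(ℝ, E) M)) x →
    dirDeriv X (fun y => inner ℝ (Y y) (Z y)) x =
      inner ℝ (nabla Y x (X x)) (Z x) + inner ℝ (Y x) (nabla Z x (X x))
  torsion : nabla.torsion = 0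

end Connection

/-- A framed metric `f`-structure `(f, ξ_i, η_i, g)` on a Riemannian manifold `(M, g)` of
dimension `2n + s`. -/
structure FramedMetricStructure (E : Type*) [NormedAddCommGroup E] [NormedSpace ℝ E]
    [FiniteDimensional ℝ E] (n s : ℕ) (M : Type*) [TopologicalSpace M] [ChartedSpace E M]
    [IsManifold 𝓘(ℝ, E) ∞ M]
    [RiemannianBundle (fun x : M => TangentSpace 𝓘(ℝ, E) x)] where
  dim : Module.finrank ℝ E = 2 * n + s
  /-- the `(1,1)` tensor field -/
  f : ∀ x : M, TangentSpace 𝓘(ℝ, E) x →L[ℝ] TangentSpace 𝓘(ℝ, E) x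
  /-- the characteristic vector fields -/
  ξ : Fin s → ∀ x : M, TangentSpace 𝓘(ℝ, E) x
  /-- the characteristic `1`-forms -/
  η : Fin s → ∀ x : M, TangentSpace 𝓘(ℝ, E) x →L[ℝ] ℝ
  f_smooth : ContMDiff 𝓘(ℝ, E)
    (𝓘(ℝ, E).prod 𝓘(ℝ, E →L[ℝ] E)) ∞
    (fun x => TotalSpace.mk' (E →L[ℝ] E)
      (E := fun x : M => TangentSpace 𝓘(ℝ, E) x →L[ℝ] TangentSpace 𝓘(ℝ, E) x) x (f x))
  ξ_smooth : ∀ i x, SmoothFieldAt (ξ i) x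
  η_smooth : ∀ i, ContMDiff 𝓘(ℝ, E)
    (𝓘(ℝ, E).prod 𝓘(ℝ, E →L[ℝ] ℝ)) ∞
    (fun x => TotalSpace.mk' (E →L[ℝ] ℝ)
      (E := fun x : M => TangentSpace 𝓘(ℝ, E) x →L[ℝ] ℝ) x (η i x))
  rank_f : ∀ x, Module.finrank ℝ (LinearMap.range (f x).toLinearMap) = 2 * n
  f_sq : ∀ x (v : TangentSpace 𝓘(ℝ, E) x), f x (f x v) = -v + ∑ i, η i x v • ξ i x
  η_ξ : ∀ i j x, η i x (ξ j x) = if i = j then 1 else 0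
  f_ξ : ∀ i x, f x (ξ i x) = 0
  η_f : ∀ i x (v : TangentSpace 𝓘(ℝ, E) x), η i x (f x v) = 0
  metric_f : ∀ x (v w : TangentSpace 𝓘(ℝ, E) x),
    inner ℝ (f x v) (f x w) = inner ℝ v w - ∑ i, η i x v * η i x w
  η_eq : ∀ i x (v : TangentSpace 𝓘(ℝ, E) x), η i x v = inner ℝ v (ξ i x)

section TransS

variable {E : Type*} [NormedAddCommGroup E] [NormedSpace ℝ E]
  [FiniteDimensional ℝ E] {n s : ℕ} {M : Type*} [TopologicalSpace M]
  [ChartedSpace E M] [IsManifold 𝓘(ℝ, E) ∞ M]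
  [RiemannianBundle (fun x : M => TangentSpace 𝓘(ℝ, E) x)]

/-- The vector field `f X`. -/
def FramedMetricStructure.fField (S : FramedMetricStructure E n s M)
    (X : ∀ x : M, TangentSpace 𝓘(ℝ, E) x) : ∀ x : M, TangentSpace 𝓘(ℝ, E) x :=
  fun x => S.f x (X x)

/-- The Nijenhuis tensor
`[f, f](X, Y) = f² [X, Y] + [f X, f Y] - f [f X, Y] - f [X, f Y]`. -/
def FramedMetricStructure.nijenhuis (S : FramedMetricStructure E n s M)
    (X Y : ∀ x : M, TangentSpace 𝓘(ℝ, E) x) (x : M) : TangentSpace 𝓘(ℝ, E) x :=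
  S.f x (S.f x (VectorField.mlieBracket 𝓘(ℝ, E) X Y x))
    + VectorField.mlieBracket 𝓘(ℝ, E) (S.fField X) (S.fField Y) x
    - S.f x (VectorField.mlieBracket 𝓘(ℝ, E) (S.fField X) Y x)
    - S.f x (VectorField.mlieBracket 𝓘(ℝ, E) X (S.fField Y) x)

/-- `2 dη_i(X, Y) = X(η_i(Y)) - Y(η_i(X)) - η_i([X, Y])` (the convention for `d` that goes with
the factor `2` in the normality condition). -/
def FramedMetricStructure.twoDEta (S : FramedMetricStructure E n s M) (i : Fin s)
    (X Y : ∀ x : M, TangentSpace 𝓘(ℝ, E) x) (x : M) : ℝ :=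
  dirDeriv X (fun y => S.η i y (Y y)) x - dirDeriv Y (fun y => S.η i y (X y)) x
    - S.η i x (VectorField.mlieBracket 𝓘(ℝ, E) X Y x)

/-- Normality: `[f, f] + 2 ∑ dη_i ⊗ ξ_i = 0`. The expression is tensorial, so fields that are
smooth near the point are as good as global ones. -/
def FramedMetricStructure.IsNormal (S : FramedMetricStructure E n s M) : Prop :=
  ∀ (X Y : ∀ x : M, TangentSpace 𝓘(ℝ, E) x) (x : M), SmoothFieldAt X x → SmoothFieldAt Y x →
    S.nijenhuis X Y x + ∑ i, S.twoDEta i X Y x • S.ξ i x = 0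

/-- The almost trans-`S` condition: the formula for
`(∇_X f) Y = ∇_X (f Y) - f (∇_X Y)` in terms of the functions `α_i`, `β_i`. -/
def FramedMetricStructure.IsAlmostTransS (S : FramedMetricStructure E n s M)
    (nabla : CovariantDerivative 𝓘(ℝ, E) E
      (fun x : M => TangentSpace 𝓘(ℝ, E) x))
    (α β : Fin s → M → ℝ) : Prop :=
  ∀ (X Y : ∀ x : M, TangentSpace 𝓘(ℝ, E) x) (x : M), SmoothFieldAt X x → SmoothFieldAt Y x →
    nabla (S.fField Y) x (X x) - S.f x (nabla Y x (X x)) =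
      ∑ i, (α i x • ((inner ℝ (S.f x (X x)) (S.f x (Y x)) : ℝ) • S.ξ i x
              + S.η i x (Y x) • S.f x (S.f x (X x)))
          + β i x • ((inner ℝ (S.f x (X x)) (Y x) : ℝ) • S.ξ i x
              - S.η i x (Y x) • S.f x (X x)))

/-- A trans-`S`-structure with smooth functions `α_i`, `β_i`: a normal almost
trans-`S`-structure. -/
structure FramedMetricStructure.IsTransS (S : FramedMetricStructure E n s M)
    (nabla : CovariantDerivative 𝓘(ℝ, E) E
      (fun x : M => TangentSpace 𝓘(ℝ, E) x))
    (α β : Fin s → M → ℝ) : Prop where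
  α_smooth : ∀ i, ContMDiff 𝓘(ℝ, E) 𝓘(ℝ, ℝ) ∞ (α i)
  β_smooth : ∀ i, ContMDiff 𝓘(ℝ, E) 𝓘(ℝ, ℝ) ∞ (β i)
  almost : S.IsAlmostTransS nabla α β
  normal : S.IsNormal

end TransS

section Curves

variable {E : Type*} [NormedAddCommGroup E] [NormedSpace ℝ E]
  [FiniteDimensional ℝ E] {M : Type*} [TopologicalSpace M] [ChartedSpace E M]
  [IsManifold 𝓘(ℝ, E) ∞ M]

/-- The velocity field `γ'` of a curve `γ : J → M`. -/
def velocity (γ : ℝ → M) (J : Set ℝ) (t : ℝ) : TangentSpace 𝓘(ℝ, E) (γ t) :=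
  (mfderivWithin 𝓘(ℝ, ℝ) 𝓘(ℝ, E) γ J t : ℝ →L[ℝ] TangentSpace 𝓘(ℝ, E) (γ t)) 1

/-- Smoothness on `J` of a vector field along `γ`. -/
def SmoothAlong (γ : ℝ → M) (J : Set ℝ) (V : ∀ t, TangentSpace 𝓘(ℝ, E) (γ t)) : Prop :=
  ContMDiffOn 𝓘(ℝ, ℝ) 𝓘(ℝ, E).tangent ∞ (fun t => (⟨γ t, V t⟩ : TangentBundle 𝓘(ℝ, E) M)) J

/-- The covariant derivative `∇_T V` of a vector field `V` along `γ`: if `(e_i)` is the coordinate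
frame around `γ t` and `V = ∑ V^i e_i ∘ γ`, it is
`∑ (V^i)'(t) e_i + V^i(t) ∇_{γ'(t)} e_i`. -/
def covAlong (nabla : CovariantDerivative 𝓘(ℝ, E) E (fun x : M => TangentSpace 𝓘(ℝ, E) x))
    (γ : ℝ → M) (J : Set ℝ) (V : ∀ t, TangentSpace 𝓘(ℝ, E) (γ t)) (t : ℝ) : TangentSpace 𝓘(ℝ, E) (γ t) :=
  let e := trivializationAt E (fun x : M => TangentSpace 𝓘(ℝ, E) x) (γ t)
  let b := Module.finBasis ℝ E
  ∑ i, (derivWithin (fun u => e.localFrameCoeff 𝓘(ℝ, E) b i (γ u) (V u)) J t •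
        e.localFrame b i (γ t)
      + e.localFrameCoeff 𝓘(ℝ, E) b i (γ t) (V t) •
        nabla (e.localFrame b i) (γ t) (velocity γ J t))

/-- The mean curvature vector field `H = ∇_T T` of a unit-speed curve. -/
def meanCurv (nabla : CovariantDerivative 𝓘(ℝ, E) E (fun x : M => TangentSpace 𝓘(ℝ, E) x))
    (γ : ℝ → M) (J : Set ℝ) : ∀ t, TangentSpace 𝓘(ℝ, E) (γ t) :=
  covAlong nabla γ J (velocity γ J)

/-- The Laplacian `Δ V = -∇_T ∇_T V` of a vector field along a unit-speed curve. -/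
def laplacianAlong (nabla : CovariantDerivative 𝓘(ℝ, E) E (fun x : M => TangentSpace 𝓘(ℝ, E) x))
    (γ : ℝ → M) (J : Set ℝ) (V : ∀ t, TangentSpace 𝓘(ℝ, E) (γ t)) : ∀ t, TangentSpace 𝓘(ℝ, E) (γ t) :=
  fun t => -covAlong nabla γ J (covAlong nabla γ J V) t

/-- `γ : J → M` is a smooth unit-speed Frenet curve of osculating order `r`, with Frenet frame
`F 1, …, F r` and curvatures `κ 1, …, κ (r - 1)`. The values of `F` and `κ` at other indices play
no role. -/
structure IsFrenetCurve [RiemannianBundle (fun x : M => TangentSpace 𝓘(ℝ, E) x)]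
    (nabla : CovariantDerivative 𝓘(ℝ, E) E (fun x : M => TangentSpace 𝓘(ℝ, E) x))
    (γ : ℝ → M) (J : Set ℝ) (r : ℕ) (F : ℕ → ∀ t, TangentSpace 𝓘(ℝ, E) (γ t)) (κ : ℕ → ℝ → ℝ) : Prop where
  smooth : ContMDiffOn 𝓘(ℝ, ℝ) 𝓘(ℝ, E) ∞ γ J
  one_le : 1 ≤ r
  le_dim : r ≤ Module.finrank ℝ E
  F_smooth : ∀ j, 1 ≤ j → j ≤ r → SmoothAlong γ J (F j)
  κ_smooth : ∀ j, 1 ≤ j → j < r → ContDiffOn ℝ ∞ (κ j) J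
  κ_pos : ∀ j, 1 ≤ j → j < r → ∀ t ∈ J, 0 < κ j t
  orthonormal : ∀ t ∈ J, ∀ i j, 1 ≤ i → i ≤ r → 1 ≤ j → j ≤ r →
    (inner ℝ (F i t) (F j t) : ℝ) = if i = j then 1 else 0
  F_one : ∀ t ∈ J, F 1 t = velocity γ J t
  frenet : ∀ t ∈ J, ∀ j, 1 ≤ j → j ≤ r →
    covAlong nabla γ J (F j) t =
      (if j = 1 then 0 else -(κ (j - 1) t • F (j - 1) t))
        + (if j = r then 0 else κ j t • F (j + 1) t)

end Curves

section CProper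

variable {E : Type*} [NormedAddCommGroup E] [NormedSpace ℝ E]
  [FiniteDimensional ℝ E] {n s : ℕ} {M : Type*} [TopologicalSpace M]
  [ChartedSpace E M] [IsManifold 𝓘(ℝ, E) ∞ M]
  [RiemannianBundle (fun x : M => TangentSpace 𝓘(ℝ, E) x)]

/-- The Legendre condition `η_i(T) = 0` for all `i`. -/
def FramedMetricStructure.IsLegendre (S : FramedMetricStructure E n s M)
    (γ : ℝ → M) (J : Set ℝ) : Prop :=
  ∀ t ∈ J, ∀ i, S.η i (γ t) (velocity γ J t) = 0

/-- `γ` is `C`-proper in the tangent bundle with the factor `lam`: `Δ H = lam ∑ ξ_i`, where `lam` is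
a non-zero differentiable function. -/
structure FramedMetricStructure.IsCProperWith (S : FramedMetricStructure E n s M)
    (nabla : CovariantDerivative 𝓘(ℝ, E) E
      (fun x : M => TangentSpace 𝓘(ℝ, E) x))
    (γ : ℝ → M) (J : Set ℝ) (lam : ℝ → ℝ) : Prop where
  diff : DifferentiableOn ℝ lam J
  ne_zero : ∀ t ∈ J, lam t ≠ 0
  eq : ∀ t ∈ J, laplacianAlong nabla γ J (meanCurv nabla γ J) t = lam t • ∑ i, S.ξ i (γ t)

/-- `γ` is `C`-proper in the tangent bundle. -/
def FramedMetricStructure.IsCProper (S : FramedMetricStructure E n s M)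
    (nabla : CovariantDerivative 𝓘(ℝ, E) E
      (fun x : M => TangentSpace 𝓘(ℝ, E) x))
    (γ : ℝ → M) (J : Set ℝ) : Prop :=
  ∃ lam : ℝ → ℝ, S.IsCProperWith nabla γ J lam

/-- The equations characterizing `C`-proper Legendre curves of osculating order `r ≥ 4`, for the
functions `lam`, `w` and `φ`. There is a fourth curvature and a fifth frame field only
if `r ≥ 5`. -/
structure FramedMetricStructure.CProperEquations (S : FramedMetricStructure E n s M)
    (α β : Fin s → M → ℝ) (γ : ℝ → M) (J : Set ℝ) (r : ℕ)
    (F : ℕ → ∀ t, TangentSpace 𝓘(ℝ, E) (γ t)) (κ : ℕ → ℝ → ℝ) (lam w φ : ℝ → ℝ) : Prop where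
  sum_ξ : ∀ t ∈ J, ∑ i, S.ξ i (γ t) = √(s : ℝ) •
    (Real.cos (w t) • F 2 t + (Real.sin (w t) * Real.cos (φ t)) • F 3 t
      + (Real.sin (w t) * Real.sin (φ t)) • F 4 t)
  κ₁_const : ∃ c : ℝ, ∀ t ∈ J, κ 1 t = c
  sum_β : ∀ t ∈ J, ∑ i, β i (γ t) = -(√(s : ℝ) * κ 1 t * Real.cos (w t))
  eq_F₂ : ∀ t ∈ J, lam t * √(s : ℝ) * Real.cos (w t) = κ 1 t * (κ 1 t ^ 2 + κ 2 t ^ 2)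
  eq_F₃ : ∀ t ∈ J, lam t * √(s : ℝ) * (Real.sin (w t) * Real.cos (φ t)) =
    -(κ 1 t * derivWithin (κ 2) J t)
  eq_F₄ : ∀ t ∈ J, lam t * √(s : ℝ) * (Real.sin (w t) * Real.sin (φ t)) =
    -(κ 1 t * κ 2 t * κ 3 t)
  κ₄_eq : 5 ≤ r → ∀ t ∈ J, κ 4 t =
    -((∑ i, α i (γ t)) * (inner ℝ (S.f (γ t) (velocity γ J t)) (F 5 t) : ℝ))
      / (√(s : ℝ) * (Real.sin (w t) * Real.sin (φ t)))

end CProper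

end TransS

end

/-! By the Frenet equations `ΔH` is a combination of `E_1, …, E_4`, with `E_1`-coefficient
`3κ_1κ_1'` and `E_4`-coefficient `-κ_1κ_2κ_3` (`IsFrenetCurve.laplacian_meanCurv`). If `ΔH = λ ∑
ξ_i`, the Legendre condition makes the `E_1`-component vanish, so `κ_1` is constant. Since `λ` has
no zeros, `∑ ξ_i` lies in the span of `E_2, E_3, E_4`. Its length is `√s` and its `E_4`-component
never vanishes, so smooth spherical angles `w, φ` exist on the whole interval
(`exists_spherical_coordinates`), and comparing coefficients gives the three equations with `λ`.

The conditions on `∑ β_i` and `κ_4` come from differentiating `⟨∑ ξ_i, E_1⟩ = 0` and `⟨∑ ξ_i, E_5⟩ =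
0` along the curve. This needs `∇_T ξ_j = -α_j fT + β_j T` (`IsTransS.nabla_ξ`): the formula for
`∇f` determines `∇_T ξ_j` up to characteristic components, and normality makes those vanish for `T`
orthogonal to all `ξ_i`.

Conversely, once `κ_1` is constant, the expansion of `∑ ξ_i` and the three equations with `λ`
reassemble `ΔH`. -/

namespace TransS

/-! ### Covariant differentiation along a curve -/

section CurveCalculus

variable {E : Type*} [NormedAddCommGroup E] [NormedSpace ℝ E]
  [FiniteDimensional ℝ E] {M : Type*} [TopologicalSpace M] [ChartedSpace E M]
  [IsManifold 𝓘(ℝ, E) ∞ M]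

/-- Near `t` the frame coefficient is a fixed linear functional of the fibre coordinate of `V` in
the trivialization at `γ t`. This makes the derivatives in `covAlong` genuine, as the sum and
product rules require. -/
theorem SmoothAlong.differentiableWithinAt_coeff {γ : ℝ → M} {J : Set ℝ}
    {V : ∀ t, TangentSpace 𝓘(ℝ, E) (γ t)} (hV : SmoothAlong γ J V) {t : ℝ} (ht : t ∈ J)
    {ι : Type*} (b : Module.Basis ι ℝ E) (i : ι) :
    DifferentiableWithinAt ℝ (fun u =>
      (trivializationAt E (fun x : M => TangentSpace 𝓘(ℝ, E) x) (γ t)).localFrameCoeff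
        𝓘(ℝ, E) b i (γ u) (V u)) J t := by
  have h := hV t ht
  rw [contMDiffWithinAt_totalSpace] at h
  obtain ⟨h1, h2⟩ := h
  have h3 := (contMDiffWithinAt_iff_contDiffWithinAt.1 h2).differentiableWithinAt (by simp)
  have h4 : DifferentiableWithinAt ℝ (fun u => b.coord i
      ((trivializationAt E (fun x : M => TangentSpace 𝓘(ℝ, E) x) (γ t)) ⟨γ u, V u⟩).2) J t :=
    ((b.coord i).toContinuousLinearMap.differentiableAt).comp_differentiableWithinAt t h3
  have hmem : ∀ u, γ u ∈ (trivializationAt E (fun x : M => TangentSpace 𝓘(ℝ, E) x) (γ t)).baseSet →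
      (trivializationAt E (fun x : M => TangentSpace 𝓘(ℝ, E) x) (γ t)).localFrameCoeff
        𝓘(ℝ, E) b i (γ u) (V u) = b.coord i
      ((trivializationAt E (fun x : M => TangentSpace 𝓘(ℝ, E) x) (γ t)) ⟨γ u, V u⟩).2 := by
    intro u hu
    -- The coefficient lemma speaks of fields on `M`, so the single vector `V u` is extended to one.
    have := (trivializationAt E (fun x : M => TangentSpace 𝓘(ℝ, E) x) (γ t)).localFrameCoeff_eq_coeff
      (I := 𝓘(ℝ, E)) (b := b) (i := i) (s := FiberBundle.extend E (V u)) hu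
    simpa using this
  refine h4.congr_of_eventuallyEq ?_ (hmem t (FiberBundle.mem_baseSet_trivializationAt' _))
  have := h1.continuousWithinAt.preimage_mem_nhdsWithin
    ((trivializationAt E (fun x : M => TangentSpace 𝓘(ℝ, E) x) (γ t)).open_baseSet.mem_nhds
      (FiberBundle.mem_baseSet_trivializationAt' _))
  filter_upwards [this] with u hu using hmem u hu

omit [FiniteDimensional ℝ E] [IsManifold 𝓘(ℝ, E) ∞ M] in
theorem hasDerivWithinAt_comp_curve {γ : ℝ → M} {J : Set ℝ} {t : ℝ}
    (hγ : MDifferentiableWithinAt 𝓘(ℝ, ℝ) 𝓘(ℝ, E) γ J t) {h : M → ℝ}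
    (hh : MDifferentiableAt 𝓘(ℝ, E) 𝓘(ℝ, ℝ) h (γ t)) :
    HasDerivWithinAt (fun u => h (γ u))
      ((mfderiv 𝓘(ℝ, E) 𝓘(ℝ, ℝ) h (γ t) : TangentSpace 𝓘(ℝ, E) (γ t) →L[ℝ] ℝ)
        (velocity γ J t)) J t := by
  set L : ℝ →L[ℝ] ℝ :=
    (mfderiv 𝓘(ℝ, E) 𝓘(ℝ, ℝ) h (γ t) : TangentSpace 𝓘(ℝ, E) (γ t) →L[ℝ] ℝ).comp
      (mfderivWithin 𝓘(ℝ, ℝ) 𝓘(ℝ, E) γ J t : ℝ →L[ℝ] TangentSpace 𝓘(ℝ, E) (γ t)) with hL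
  have : HasFDerivWithinAt (fun u => h (γ u)) L J t :=
    (hh.hasMFDerivAt.comp_hasMFDerivWithinAt t hγ.hasMFDerivWithinAt).hasFDerivWithinAt
  exact HasFDerivWithinAt.hasDerivWithinAt (f' := L) this

theorem covAlong_congr {nabla : CovariantDerivative 𝓘(ℝ, E) E (fun x : M => TangentSpace 𝓘(ℝ, E) x)}
    {γ : ℝ → M} {J : Set ℝ} {V W : ∀ t, TangentSpace 𝓘(ℝ, E) (γ t)}
    (h : ∀ t ∈ J, V t = W t) {t : ℝ} (ht : t ∈ J) :
    covAlong nabla γ J V t = covAlong nabla γ J W t := by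
  simp only [covAlong]
  refine Finset.sum_congr rfl fun i _ => ?_
  rw [h t ht, derivWithin_congr (fun u hu => by rw [h u hu]) (by rw [h t ht])]

theorem covAlong_add {nabla : CovariantDerivative 𝓘(ℝ, E) E (fun x : M => TangentSpace 𝓘(ℝ, E) x)}
    {γ : ℝ → M} {J : Set ℝ} {V W : ∀ t, TangentSpace 𝓘(ℝ, E) (γ t)}
    (hV : SmoothAlong γ J V) (hW : SmoothAlong γ J W) {t : ℝ} (ht : t ∈ J) :
    covAlong nabla γ J (fun u => V u + W u) t = covAlong nabla γ J V t + covAlong nabla γ J W t := by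
  simp only [covAlong, map_add]
  rw [← Finset.sum_add_distrib]
  refine Finset.sum_congr rfl fun i _ => ?_
  rw [derivWithin_fun_add (hV.differentiableWithinAt_coeff ht _ i)
    (hW.differentiableWithinAt_coeff ht _ i)]
  module

theorem covAlong_smul {nabla : CovariantDerivative 𝓘(ℝ, E) E (fun x : M => TangentSpace 𝓘(ℝ, E) x)}
    {γ : ℝ → M} {J : Set ℝ} {V : ∀ t, TangentSpace 𝓘(ℝ, E) (γ t)} (hV : SmoothAlong γ J V)
    {c : ℝ → ℝ} {t : ℝ} (ht : t ∈ J) (hc : DifferentiableWithinAt ℝ c J t) :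
    covAlong nabla γ J (fun u => c u • V u) t =
      derivWithin c J t • V t + c t • covAlong nabla γ J V t := by
  have hVt := (trivializationAt E (fun x : M => TangentSpace 𝓘(ℝ, E) x)
    (γ t)).eq_sum_localFrameCoeff_smul (I := 𝓘(ℝ, E)) (b := Module.finBasis ℝ E)
    (s := FiberBundle.extend E (V t)) (FiberBundle.mem_baseSet_trivializationAt' (γ t))
  rw [FiberBundle.extend_apply_self] at hVt
  conv_rhs => rw [hVt]
  simp only [covAlong, map_smul, smul_eq_mul]
  rw [Finset.smul_sum, Finset.smul_sum, ← Finset.sum_add_distrib]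
  refine Finset.sum_congr rfl fun i _ => ?_
  rw [derivWithin_fun_mul hc (hV.differentiableWithinAt_coeff ht _ i)]
  module

omit [FiniteDimensional ℝ E] in
theorem SmoothAlong.add {γ : ℝ → M} {J : Set ℝ} {V W : ∀ t, TangentSpace 𝓘(ℝ, E) (γ t)}
    (hV : SmoothAlong γ J V) (hW : SmoothAlong γ J W) : SmoothAlong γ J (fun u => V u + W u) := by
  intro t ht
  have h1 := hV t ht
  have h2 := hW t ht
  rw [contMDiffWithinAt_totalSpace] at h1 h2 ⊢
  refine ⟨h1.1, (h1.2.add h2.2).congr_of_eventuallyEq ?_ ?_⟩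
  · have := h1.1.continuousWithinAt.preimage_mem_nhdsWithin
      ((trivializationAt E (fun x : M => TangentSpace 𝓘(ℝ, E) x) (γ t)).open_baseSet.mem_nhds
        (FiberBundle.mem_baseSet_trivializationAt' _))
    filter_upwards [this] with u hu
    exact ((trivializationAt E (fun x : M => TangentSpace 𝓘(ℝ, E) x) (γ t)).linear ℝ hu).1 _ _
  · exact ((trivializationAt E (fun x : M => TangentSpace 𝓘(ℝ, E) x) (γ t)).linear ℝ
      (FiberBundle.mem_baseSet_trivializationAt' _)).1 _ _

omit [FiniteDimensional ℝ E] in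
theorem SmoothAlong.smul {γ : ℝ → M} {J : Set ℝ} {V : ∀ t, TangentSpace 𝓘(ℝ, E) (γ t)}
    (hV : SmoothAlong γ J V) {c : ℝ → ℝ} (hc : ContDiffOn ℝ ∞ c J) :
    SmoothAlong γ J (fun u => c u • V u) := by
  intro t ht
  have h1 := hV t ht
  have h2 := (hc t ht).contMDiffWithinAt
  rw [contMDiffWithinAt_totalSpace] at h1 ⊢
  refine ⟨h1.1, (h2.smul h1.2).congr_of_eventuallyEq ?_ ?_⟩
  · have := h1.1.continuousWithinAt.preimage_mem_nhdsWithin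
      ((trivializationAt E (fun x : M => TangentSpace 𝓘(ℝ, E) x) (γ t)).open_baseSet.mem_nhds
        (FiberBundle.mem_baseSet_trivializationAt' _))
    filter_upwards [this] with u hu
    exact ((trivializationAt E (fun x : M => TangentSpace 𝓘(ℝ, E) x) (γ t)).linear ℝ hu).2 _ _
  · exact ((trivializationAt E (fun x : M => TangentSpace 𝓘(ℝ, E) x) (γ t)).linear ℝ
      (FiberBundle.mem_baseSet_trivializationAt' _)).2 _ _

variable [RiemannianBundle (fun x : M => TangentSpace 𝓘(ℝ, E) x)]
  [IsContMDiffRiemannianBundle 𝓘(ℝ, E) ∞ E (fun x : M => TangentSpace 𝓘(ℝ, E) x)]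

/-- Expanding `W` in the coordinate frame reduces the product rule along `γ` to metric compatibility
for genuine fields on `M`: `X` and the frame fields. -/
theorem hasDerivWithinAt_inner_field
    {nabla : CovariantDerivative 𝓘(ℝ, E) E (fun x : M => TangentSpace 𝓘(ℝ, E) x)}
    (hnabla : IsLeviCivita nabla) {γ : ℝ → M} {J : Set ℝ} {t : ℝ} (ht : t ∈ J)
    (hγ : MDifferentiableWithinAt 𝓘(ℝ, ℝ) 𝓘(ℝ, E) γ J t)
    {X : ∀ x : M, TangentSpace 𝓘(ℝ, E) x} (hX : SmoothFieldAt X (γ t))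
    {W : ∀ t, TangentSpace 𝓘(ℝ, E) (γ t)} (hW : SmoothAlong γ J W) :
    HasDerivWithinAt (fun u => (inner ℝ (X (γ u)) (W u) : ℝ))
      (inner ℝ (nabla X (γ t) (velocity γ J t)) (W t)
        + inner ℝ (X (γ t)) (covAlong nabla γ J W t)) J t := by
  set e := trivializationAt E (fun x : M => TangentSpace 𝓘(ℝ, E) x) (γ t) with he
  set b := Module.finBasis ℝ E with hb
  have hmem : γ t ∈ e.baseSet := FiberBundle.mem_baseSet_trivializationAt' (γ t)
  have hexp : ∀ u, γ u ∈ e.baseSet →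
      W u = ∑ i, e.localFrameCoeff 𝓘(ℝ, E) b i (γ u) (W u) • e.localFrame b i (γ u) := by
    intro u hu
    have := e.eq_sum_localFrameCoeff_smul (I := 𝓘(ℝ, E)) (b := b)
      (s := FiberBundle.extend E (W u)) hu
    rwa [FiberBundle.extend_apply_self] at this
  have hframe : ∀ i, MDifferentiableAt 𝓘(ℝ, E) 𝓘(ℝ, E).tangent
      (fun y => (⟨y, e.localFrame b i y⟩ : TangentBundle 𝓘(ℝ, E) M)) (γ t) := fun i =>
    (contMDiffAt_localFrame_of_mem (n := 1) e b i hmem).mdifferentiableAt one_ne_zero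
  have hX' : MDifferentiableAt 𝓘(ℝ, E) 𝓘(ℝ, E).tangent
      (fun y => (⟨y, X y⟩ : TangentBundle 𝓘(ℝ, E) M)) (γ t) := hX.mdifferentiableAt (by simp)
  have hterm : ∀ i, HasDerivWithinAt
      (fun u => e.localFrameCoeff 𝓘(ℝ, E) b i (γ u) (W u) *
        (inner ℝ (X (γ u)) (e.localFrame b i (γ u)) : ℝ))
      (derivWithin (fun u => e.localFrameCoeff 𝓘(ℝ, E) b i (γ u) (W u)) J t *
        (inner ℝ (X (γ t)) (e.localFrame b i (γ t)) : ℝ) +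
        e.localFrameCoeff 𝓘(ℝ, E) b i (γ t) (W t) *
        (inner ℝ (nabla X (γ t) (velocity γ J t)) (e.localFrame b i (γ t))
          + inner ℝ (X (γ t)) (nabla (e.localFrame b i) (γ t) (velocity γ J t)))) J t := by
    intro i
    refine (hW.differentiableWithinAt_coeff ht b i).hasDerivWithinAt.mul ?_
    have hg : MDifferentiableAt 𝓘(ℝ, E) 𝓘(ℝ, ℝ)
        (fun y => (inner ℝ (X y) (e.localFrame b i y) : ℝ)) (γ t) :=
      MDifferentiableAt.inner_bundle hX' (hframe i)
    have h1 := hasDerivWithinAt_comp_curve hγ hg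
    have h2 := hnabla.metric (FiberBundle.extend E (velocity γ J t)) X (e.localFrame b i) (γ t)
      hX' (hframe i)
    simp only [dirDeriv, FiberBundle.extend_apply_self] at h2
    rwa [h2] at h1
  have hsum := HasDerivWithinAt.fun_sum (u := Finset.univ) fun i _ => hterm i
  have hval : ∀ u, γ u ∈ e.baseSet → (inner ℝ (X (γ u)) (W u) : ℝ) =
      ∑ i, e.localFrameCoeff 𝓘(ℝ, E) b i (γ u) (W u) *
        (inner ℝ (X (γ u)) (e.localFrame b i (γ u)) : ℝ) := by
    intro u hu
    conv_lhs => rw [hexp u hu]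
    simp [inner_sum, inner_smul_right]
  have h3 := hsum.congr_of_eventuallyEq (f₁ := fun u => (inner ℝ (X (γ u)) (W u) : ℝ))
    (by
      filter_upwards [hγ.continuousWithinAt.preimage_mem_nhdsWithin
        (e.open_baseSet.mem_nhds hmem)] with u hu using hval u hu) (hval t hmem)
  convert! h3 using 1
  conv_lhs => rw [hexp t hmem]
  simp only [covAlong, inner_sum, inner_smul_right, inner_add_right]
  rw [← Finset.sum_add_distrib]
  refine Finset.sum_congr rfl fun i _ => ?_
  simp only [← he, ← hb]
  ring

end CurveCalculus

/-! ### Derivatives of the characteristic fields -/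

section Structure

variable {E : Type*} [NormedAddCommGroup E] [NormedSpace ℝ E]
  [FiniteDimensional ℝ E] {n s : ℕ} {M : Type*} [TopologicalSpace M]
  [ChartedSpace E M] [IsManifold 𝓘(ℝ, E) ∞ M]
  [RiemannianBundle (fun x : M => TangentSpace 𝓘(ℝ, E) x)]

namespace FramedMetricStructure

theorem inner_ξ (S : FramedMetricStructure E n s M) (x : M) (v : TangentSpace 𝓘(ℝ, E) x)
    (i : Fin s) : (inner ℝ v (S.ξ i x) : ℝ) = S.η i x v := (S.η_eq i x v).symm

/-- Compatibility of `f` with the metric, applied to `v` and `fv`, gives `g(fv, f²v) = g(v, fv)`,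
while `f²v = -v` modulo the `ξ_i`, which are orthogonal to `fv`. So the product equals its own
negative. -/
theorem inner_f_self (S : FramedMetricStructure E n s M) (x : M) (v : TangentSpace 𝓘(ℝ, E) x) :
    (inner ℝ (S.f x v) v : ℝ) = 0 := by
  have h := S.metric_f x v (S.f x v)
  rw [S.f_sq, inner_add_right, inner_neg_right, inner_sum] at h
  simp only [inner_smul_right, S.inner_ξ, S.η_f, mul_zero, Finset.sum_const_zero] at h
  rw [real_inner_comm] at h
  rw [real_inner_comm]
  linarith

theorem inner_sum_ξ_self (S : FramedMetricStructure E n s M) (x : M) :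
    (inner ℝ (∑ i, S.ξ i x) (∑ i, S.ξ i x) : ℝ) = s := by
  rw [sum_inner]
  simp [inner_sum, S.inner_ξ, S.η_ξ]

theorem fField_ξ (S : FramedMetricStructure E n s M) (j : Fin s) : S.fField (S.ξ j) = 0 := by
  funext x
  exact S.f_ξ j x

theorem mdifferentiableAt_ξ (S : FramedMetricStructure E n s M) (j : Fin s) (x : M) :
    MDifferentiableAt 𝓘(ℝ, E) 𝓘(ℝ, E).tangent
      (fun y => (⟨y, S.ξ j y⟩ : TangentBundle 𝓘(ℝ, E) M)) x :=
  (S.ξ_smooth j x).mdifferentiableAt (by simp)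

variable {nabla : CovariantDerivative 𝓘(ℝ, E) E (fun x : M => TangentSpace 𝓘(ℝ, E) x)}

/-- `f (∇_v ξ_j) = -α_j f² v + β_j f v`. -/
theorem IsAlmostTransS.f_nabla_ξ {S : FramedMetricStructure E n s M} {α β : Fin s → M → ℝ}
    (h : S.IsAlmostTransS nabla α β) (j : Fin s) (x : M) (v : TangentSpace 𝓘(ℝ, E) x) :
    S.f x (nabla (S.ξ j) x v) = -(α j x • S.f x (S.f x v)) + β j x • S.f x v := by
  -- With `Y = ξ_j` the term `∇(fY)` vanishes and only `-f(∇_v ξ_j)` remains on the left.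
  have h1 := h (FiberBundle.extend E v) (S.ξ j) x (FiberBundle.contMDiffAt_extend _ _ _)
    (S.ξ_smooth j x)
  have h0 : nabla (0 : ∀ x : M, TangentSpace 𝓘(ℝ, E) x) x = 0 :=
    nabla.isCovariantDerivativeOn.zero
  rw [S.fField_ξ, h0] at h1
  simp only [FiberBundle.extend_apply_self, S.f_ξ, S.inner_ξ, S.η_f, inner_zero_right, zero_smul,
    zero_add, S.η_ξ, ite_smul, one_smul, smul_ite, smul_zero, zero_sub, smul_neg,
    Finset.sum_add_distrib, Finset.sum_neg_distrib, Finset.sum_ite_eq', Finset.mem_univ,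
    if_true, zero_apply] at h1
  rw [← neg_neg (S.f x (nabla (S.ξ j) x v)), h1]
  abel

/-- `∇_v ξ_j` up to its components along the characteristic fields. -/
theorem IsAlmostTransS.nabla_ξ {S : FramedMetricStructure E n s M} {α β : Fin s → M → ℝ}
    (h : S.IsAlmostTransS nabla α β) (j : Fin s) (x : M) (v : TangentSpace 𝓘(ℝ, E) x) :
    nabla (S.ξ j) x v = -(α j x • S.f x v) - β j x • S.f x (S.f x v)
      + ∑ k, S.η k x (nabla (S.ξ j) x v) • S.ξ k x := by
  -- A second application of `f` inverts it up to characteristic components, since `f² = -I + ∑ η_i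
  -- ⊗ ξ_i` and `f³ = -f`.
  have h1 := congrArg (S.f x) (h.f_nabla_ξ j x v)
  have h3 : S.f x (S.f x (S.f x v)) = - S.f x v := by
    rw [S.f_sq x (S.f x v)]
    simp [S.η_f]
  rw [S.f_sq, map_add, map_neg, map_smul, map_smul, h3] at h1
  rw [← sub_eq_zero] at h1 ⊢
  rw [← neg_eq_zero, ← h1]
  module

/-- On the pair `(X, ξ_j)` the Nijenhuis tensor takes values in the image of `f`, so normality gives
`dη_k(X, ξ_j) = 0`. By metric compatibility and vanishing torsion this reads `η_k(∇_v ξ_j) = -⟨v,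
∇_{ξ_j} ξ_k⟩`. The right side is zero because `∇_{ξ_j} ξ_k` is a combination of the `ξ_i`. -/
theorem IsTransS.η_nabla_ξ {S : FramedMetricStructure E n s M} {α β : Fin s → M → ℝ}
    (h : S.IsTransS nabla α β) (hnabla : IsLeviCivita nabla) (j k : Fin s) (x : M)
    (v : TangentSpace 𝓘(ℝ, E) x) (hv : ∀ i, S.η i x v = 0) :
    S.η k x (nabla (S.ξ j) x v) = 0 := by
  set X : ∀ x : M, TangentSpace 𝓘(ℝ, E) x := FiberBundle.extend E v with hX
  have hXx : X x = v := FiberBundle.extend_apply_self _ _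
  have hXs : SmoothFieldAt X x := FiberBundle.contMDiffAt_extend _ _ _
  have hXd := hXs.mdifferentiableAt (n := ∞) (by simp)
  have h1 := congrArg (S.η k x) (h.normal X (S.ξ j) x hXs (S.ξ_smooth j x))
  have h2 : S.twoDEta k X (S.ξ j) x = 0 := by
    simpa [nijenhuis, S.fField_ξ, S.η_f, S.η_ξ] using h1
  have h3 : nabla (S.ξ j) x (X x) - nabla X x (S.ξ j x)
      = VectorField.mlieBracket 𝓘(ℝ, E) X (S.ξ j) x :=
    nabla.torsion_eq_zero_iff.1 hnabla.torsion hXd (S.mdifferentiableAt_ξ j x)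
  have h4 := hnabla.metric (S.ξ j) X (S.ξ k) x hXd (S.mdifferentiableAt_ξ k x)
  have h5 : dirDeriv X (fun y => S.η k y (S.ξ j y)) x = 0 := by
    have hc : (fun y => S.η k y (S.ξ j y)) = fun _ => if k = j then 1 else 0 :=
      funext fun y => S.η_ξ k j y
    rw [hc]
    exact congrArg (fun L : TangentSpace 𝓘(ℝ, E) x →L[ℝ] ℝ => L (X x)) mfderiv_const
  have h6 : nabla (S.ξ k) x (S.ξ j x)
      = ∑ i, S.η i x (nabla (S.ξ k) x (S.ξ j x)) • S.ξ i x := by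
    have := h.almost.nabla_ξ k x (S.ξ j x)
    simpa [S.f_ξ] using this
  have h7 : (inner ℝ v (nabla (S.ξ k) x (S.ξ j x)) : ℝ) = 0 := by
    rw [h6, inner_sum]
    simp [inner_smul_right, S.inner_ξ, hv]
  simp only [S.inner_ξ, hXx, h7] at h4
  simp only [twoDEta, h5, h4, ← h3, map_sub, hXx] at h2
  linarith

/-- `∇_v ξ_j = -α_j f v + β_j v` for vectors `v` orthogonal to the characteristic fields. -/
theorem IsTransS.nabla_ξ {S : FramedMetricStructure E n s M} {α β : Fin s → M → ℝ}
    (h : S.IsTransS nabla α β) (hnabla : IsLeviCivita nabla) (j : Fin s) (x : M)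
    (v : TangentSpace 𝓘(ℝ, E) x) (hv : ∀ i, S.η i x v = 0) :
    nabla (S.ξ j) x v = -(α j x • S.f x v) + β j x • v := by
  have h1 := h.almost.nabla_ξ j x v
  simp only [h.η_nabla_ξ hnabla j _ x v hv, zero_smul, Finset.sum_const_zero, add_zero, S.f_sq,
    hv] at h1
  rw [h1]
  module

end FramedMetricStructure

end Structure

/-! ### Real functions on an interval and spherical coordinates -/

section RealFunctions

variable {J : Set ℝ}

theorem uniqueDiffOn_of_ordConnected (hJ : J.OrdConnected) (hJ' : J.Nontrivial) :
    UniqueDiffOn ℝ J := by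
  obtain ⟨a, ha, b, hb, hab⟩ := hJ'.exists_lt
  refine uniqueDiffOn_convex hJ.convex ⟨(a + b) / 2, ?_⟩
  exact interior_mono (hJ.out ha hb) (by rw [interior_Icc]; constructor <;> linarith)

theorem exists_eq_const_of_derivWithin_eq_zero (hJ : J.OrdConnected) {h : ℝ → ℝ}
    (hd : DifferentiableOn ℝ h J) (h0 : ∀ t ∈ J, derivWithin h J t = 0) :
    ∃ c : ℝ, ∀ t ∈ J, h t = c := by
  rcases J.eq_empty_or_nonempty with rfl | ⟨a, ha⟩
  · exact ⟨0, by simp⟩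
  · refine ⟨h a, fun t ht => ?_⟩
    have := hJ.convex.norm_image_sub_le_of_norm_derivWithin_le (C := 0) hd
      (fun x hx => by rw [h0 x hx, norm_zero]) ha ht
    rw [zero_mul] at this
    exact sub_eq_zero.1 (norm_le_zero_iff.1 this)

theorem contDiffOn_arccos_comp {g : ℝ → ℝ} (hg : ContDiffOn ℝ ∞ g J) (h1 : ∀ t ∈ J, g t ^ 2 < 1) :
    ContDiffOn ℝ ∞ (fun t => Real.arccos (g t)) J := by
  refine Real.contDiffOn_arccos.comp hg fun t ht => ?_
  have := h1 t ht
  simp only [mem_compl_iff, mem_insert_iff, mem_singleton_iff, not_or]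
  constructor <;> intro h <;> rw [h] at this <;> norm_num at this

/-- Smooth spherical coordinates of a smooth curve on the unit sphere whose last coordinate does
not vanish. -/
theorem exists_spherical_coordinates (hJ : J.OrdConnected) {A B C : ℝ → ℝ}
    (hA : ContDiffOn ℝ ∞ A J) (hB : ContDiffOn ℝ ∞ B J) (hC : ContDiffOn ℝ ∞ C J)
    (hsq : ∀ t ∈ J, A t ^ 2 + B t ^ 2 + C t ^ 2 = 1) (hC0 : ∀ t ∈ J, C t ≠ 0) :
    ∃ w φ : ℝ → ℝ, ContDiffOn ℝ ∞ w J ∧ ContDiffOn ℝ ∞ φ J ∧ ∀ t ∈ J,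
      Real.cos (w t) = A t ∧ Real.sin (w t) * Real.cos (φ t) = B t ∧
        Real.sin (w t) * Real.sin (φ t) = C t := by
  have hCpos : ∀ t ∈ J, 0 < C t ^ 2 := fun t ht => by have := hC0 t ht; positivity
  have hA1 : ∀ t ∈ J, A t ^ 2 < 1 := fun t ht => by
    nlinarith [hsq t ht, hCpos t ht, sq_nonneg (B t)]
  -- `R` will be `sin w`. As `C ≠ 0`, both `A` and `B / R` stay strictly between `-1` and `1`, where
  -- `arccos` is smooth.
  set R : ℝ → ℝ := fun t => √(1 - A t ^ 2) with hR
  have hRsq : ∀ t ∈ J, R t ^ 2 = B t ^ 2 + C t ^ 2 := fun t ht => by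
    rw [hR, Real.sq_sqrt (by linarith [hA1 t ht])]; linarith [hsq t ht]
  have hRpos : ∀ t ∈ J, 0 < R t := fun t ht => Real.sqrt_pos.2 (by linarith [hA1 t ht])
  have hRs : ContDiffOn ℝ ∞ R J :=
    (contDiffOn_const.sub (hA.pow 2)).sqrt fun t ht => by linarith [hA1 t ht]
  have hQs : ContDiffOn ℝ ∞ (fun t => B t / R t) J := hB.div hRs fun t ht => (hRpos t ht).ne'
  have hQsq : ∀ t ∈ J, 1 - (B t / R t) ^ 2 = (C t / R t) ^ 2 := fun t ht => by
    have := (hRpos t ht).ne'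
    field_simp
    linarith [hRsq t ht]
  have hQ1 : ∀ t ∈ J, (B t / R t) ^ 2 < 1 := fun t ht => by
    have h1 : 0 < (C t / R t) ^ 2 := by
      have := div_ne_zero (hC0 t ht) (hRpos t ht).ne'
      positivity
    linarith [hQsq t ht]
  -- `arccos` only yields angles with nonnegative sine. Since `C` has no zeros on an interval its
  -- sign `σ` is constant, so multiplying the angle by `σ` corrects the sine and keeps smoothness.
  obtain ⟨σ, hσ⟩ : ∃ σ : ℝ, (σ = 1 ∨ σ = -1) ∧ ∀ t ∈ J, σ * |C t| = C t := by
    rcases J.eq_empty_or_nonempty with rfl | ⟨a, ha⟩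
    · exact ⟨1, by simp⟩
    have hsign : (∀ t ∈ J, 0 < C t) ∨ ∀ t ∈ J, C t < 0 := by
      by_contra! hcon
      obtain ⟨⟨p, hp, hp'⟩, q, hq, hq'⟩ := hcon
      obtain ⟨z, hz, hz'⟩ := hJ.isPreconnected.intermediate_value hp hq hC.continuousOn ⟨hp', hq'⟩
      exact hC0 z hz hz'
    rcases hsign with h | h
    · exact ⟨1, .inl rfl, fun t ht => by rw [abs_of_pos (h t ht), one_mul]⟩
    · exact ⟨-1, .inr rfl, fun t ht => by rw [abs_of_neg (h t ht)]; ring⟩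
  refine ⟨fun t => Real.arccos (A t), fun t => σ * Real.arccos (B t / R t),
    contDiffOn_arccos_comp hA hA1, contDiffOn_const.mul (contDiffOn_arccos_comp hQs hQ1), fun t ht => ?_⟩
  have hbound : ∀ x : ℝ, x ^ 2 < 1 → Real.cos (Real.arccos x) = x := fun x hx =>
    Real.cos_arccos (abs_le.1 ((sq_lt_one_iff_abs_lt_one x).1 hx).le).1
      (abs_le.1 ((sq_lt_one_iff_abs_lt_one x).1 hx).le).2
  have hR0 := (hRpos t ht).ne'
  have hsw : Real.sin (Real.arccos (A t)) = R t := Real.sin_arccos _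
  have hsq' : Real.sin (Real.arccos (B t / R t)) = |C t| / R t := by
    rw [Real.sin_arccos, hQsq t ht, Real.sqrt_sq_eq_abs, abs_div, abs_of_pos (hRpos t ht)]
  have hcos : Real.cos (σ * Real.arccos (B t / R t)) = B t / R t := by
    rcases hσ.1 with h | h
    · rw [h, one_mul, hbound _ (hQ1 t ht)]
    · rw [h, neg_one_mul, Real.cos_neg, hbound _ (hQ1 t ht)]
  have hsin : Real.sin (σ * Real.arccos (B t / R t)) = C t / R t := by
    rw [← hσ.2 t ht, mul_div_assoc, ← hsq']
    rcases hσ.1 with h | h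
    · simp only [h, one_mul]
    · simp only [h, neg_one_mul, Real.sin_neg]
  refine ⟨hbound _ (hA1 t ht), ?_, ?_⟩
  · rw [hsw, hcos]; field_simp
  · rw [hsw, hsin]; field_simp

end RealFunctions

/-! ### The Laplacian of the mean curvature vector of a Frenet curve -/

section FrenetLaplacian

variable {E : Type*} [NormedAddCommGroup E] [NormedSpace ℝ E]
  [FiniteDimensional ℝ E] {M : Type*} [TopologicalSpace M] [ChartedSpace E M]
  [IsManifold 𝓘(ℝ, E) ∞ M] [RiemannianBundle (fun x : M => TangentSpace 𝓘(ℝ, E) x)]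
  {nabla : CovariantDerivative 𝓘(ℝ, E) E (fun x : M => TangentSpace 𝓘(ℝ, E) x)}
  {J : Set ℝ} {γ : ℝ → M} {r : ℕ} {F : ℕ → ∀ t, TangentSpace 𝓘(ℝ, E) (γ t)} {κ : ℕ → ℝ → ℝ}

theorem IsFrenetCurve.meanCurv_eq (hγ : IsFrenetCurve nabla γ J r F κ) (hr : 4 ≤ r) {t : ℝ}
    (ht : t ∈ J) : meanCurv nabla γ J t = κ 1 t • F 2 t := by
  have h := hγ.frenet t ht 1 le_rfl (by lia)
  rw [if_pos rfl, if_neg (by lia), zero_add] at h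
  rw [← h]
  exact covAlong_congr (fun u hu => (hγ.F_one u hu).symm) ht

/-- Differentiating `H = κ_1 E_2` gives `∇_T H = -κ_1² E_1 + κ_1' E_2 + κ_1κ_2 E_3`. One more
derivative uses the Frenet equations of `E_1, E_2, E_3` only, so no case distinction on `r ≥ 4`
arises. -/
theorem IsFrenetCurve.laplacian_meanCurv (hJ : UniqueDiffOn ℝ J)
    (hγ : IsFrenetCurve nabla γ J r F κ) (hr : 4 ≤ r) {t : ℝ} (ht : t ∈ J) :
    laplacianAlong nabla γ J (meanCurv nabla γ J) t =
      (3 * κ 1 t * derivWithin (κ 1) J t) • F 1 t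
      + (κ 1 t * (κ 1 t ^ 2 + κ 2 t ^ 2) - derivWithin (derivWithin (κ 1) J) J t) • F 2 t
      + (-(2 * derivWithin (κ 1) J t * κ 2 t + κ 1 t * derivWithin (κ 2) J t)) • F 3 t
      + (-(κ 1 t * κ 2 t * κ 3 t)) • F 4 t := by
  have hF : ∀ j, 1 ≤ j → j ≤ 4 → SmoothAlong γ J (F j) := fun j h1 h2 =>
    hγ.F_smooth j h1 (by lia)
  have hκ : ∀ j, 1 ≤ j → j ≤ 3 → ContDiffOn ℝ ∞ (κ j) J := fun j h1 h2 =>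
    hγ.κ_smooth j h1 (by lia)
  have hd : ∀ {g : ℝ → ℝ}, ContDiffOn ℝ ∞ g J → ∀ u ∈ J, DifferentiableWithinAt ℝ g J u :=
    fun hg u hu => (hg u hu).differentiableWithinAt (by simp)
  have hκ1 := hκ 1 (by lia) (by lia)
  have hκ2 := hκ 2 (by lia) (by lia)
  have hκ1' : ContDiffOn ℝ ∞ (derivWithin (κ 1) J) J := hκ1.derivWithin hJ (by simp)
  have f1 : ∀ u ∈ J, covAlong nabla γ J (F 1) u = κ 1 u • F 2 u := fun u hu => by
    have h := hγ.frenet u hu 1 le_rfl (by lia)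
    rwa [if_pos rfl, if_neg (by lia), zero_add] at h
  have f2 : ∀ u ∈ J, covAlong nabla γ J (F 2) u = -(κ 1 u • F 1 u) + κ 2 u • F 3 u :=
    fun u hu => by
      have h := hγ.frenet u hu 2 (by lia) (by lia)
      rwa [if_neg (by lia), if_neg (by lia)] at h
  have f3 : ∀ u ∈ J, covAlong nabla γ J (F 3) u = -(κ 2 u • F 2 u) + κ 3 u • F 4 u :=
    fun u hu => by
      have h := hγ.frenet u hu 3 (by lia) (by lia)
      rwa [if_neg (by lia), if_neg (by lia)] at h
  have hs1 : ContDiffOn ℝ ∞ (fun u => -(κ 1 u * κ 1 u)) J := (hκ1.mul hκ1).neg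
  have hs2 : ContDiffOn ℝ ∞ (fun u => κ 1 u * κ 2 u) J := hκ1.mul hκ2
  have g1 : ∀ u ∈ J, covAlong nabla γ J (meanCurv nabla γ J) u =
      (-(κ 1 u * κ 1 u)) • F 1 u + (derivWithin (κ 1) J u • F 2 u + (κ 1 u * κ 2 u) • F 3 u) := by
    intro u hu
    rw [covAlong_congr (fun v hv => hγ.meanCurv_eq hr hv) hu,
      covAlong_smul (hF 2 (by lia) (by lia)) hu (hd hκ1 u hu), f2 u hu]
    module
  have V1 := (hF 1 (by lia) (by lia)).smul hs1
  have V2 := (hF 2 (by lia) (by lia)).smul hκ1'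
  have V3 := (hF 3 (by lia) (by lia)).smul hs2
  rw [laplacianAlong, covAlong_congr g1 ht, covAlong_add V1 (V2.add V3) ht, covAlong_add V2 V3 ht,
    covAlong_smul (hF 1 (by lia) (by lia)) ht (hd hs1 t ht),
    covAlong_smul (hF 2 (by lia) (by lia)) ht (hd hκ1' t ht),
    covAlong_smul (hF 3 (by lia) (by lia)) ht (hd hs2 t ht), f1 t ht, f2 t ht, f3 t ht,
    derivWithin.fun_neg, derivWithin_fun_mul (hd hκ1 t ht) (hd hκ1 t ht),
    derivWithin_fun_mul (hd hκ1 t ht) (hd hκ2 t ht)]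
  module

theorem IsFrenetCurve.laplacian_meanCurv_of_const (hJ : UniqueDiffOn ℝ J)
    (hγ : IsFrenetCurve nabla γ J r F κ) (hr : 4 ≤ r) (hc : ∃ c : ℝ, ∀ t ∈ J, κ 1 t = c) {t : ℝ}
    (ht : t ∈ J) :
    laplacianAlong nabla γ J (meanCurv nabla γ J) t =
      (κ 1 t * (κ 1 t ^ 2 + κ 2 t ^ 2)) • F 2 t + (-(κ 1 t * derivWithin (κ 2) J t)) • F 3 t
      + (-(κ 1 t * κ 2 t * κ 3 t)) • F 4 t := by
  obtain ⟨c, hc⟩ := hc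
  have h1 : ∀ u ∈ J, derivWithin (κ 1) J u = 0 := fun u hu => by
    rw [derivWithin_congr (f := fun _ => c) hc (hc u hu)]
    simp
  have h2 : derivWithin (derivWithin (κ 1) J) J t = 0 := by
    rw [derivWithin_congr (f := fun _ => (0 : ℝ)) h1 (h1 t ht)]
    simp
  rw [hγ.laplacian_meanCurv hJ hr ht, h2, h1 t ht]
  module

end FrenetLaplacian

/-! ### `C`-proper Legendre curves -/

section CProperCurves

variable {E : Type*} [NormedAddCommGroup E] [NormedSpace ℝ E]
  [FiniteDimensional ℝ E] {n s : ℕ} {M : Type*} [TopologicalSpace M]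
  [ChartedSpace E M] [IsManifold 𝓘(ℝ, E) ∞ M]
  [RiemannianBundle (fun x : M => TangentSpace 𝓘(ℝ, E) x)]
  [IsContMDiffRiemannianBundle 𝓘(ℝ, E) ∞ E (fun x : M => TangentSpace 𝓘(ℝ, E) x)]
  {nabla : CovariantDerivative 𝓘(ℝ, E) E (fun x : M => TangentSpace 𝓘(ℝ, E) x)}
  {S : FramedMetricStructure E n s M} {α β : Fin s → M → ℝ}
  {J : Set ℝ} {γ : ℝ → M} {r : ℕ} {F : ℕ → ∀ t, TangentSpace 𝓘(ℝ, E) (γ t)} {κ : ℕ → ℝ → ℝ}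

namespace FramedMetricStructure

theorem IsTransS.hasDerivWithinAt_inner_sum_ξ (hS : S.IsTransS nabla α β)
    (hnabla : IsLeviCivita nabla) (hγ : ContMDiffOn 𝓘(ℝ, ℝ) 𝓘(ℝ, E) ∞ γ J)
    (hL : S.IsLegendre γ J) {W : ∀ t, TangentSpace 𝓘(ℝ, E) (γ t)} (hW : SmoothAlong γ J W)
    {t : ℝ} (ht : t ∈ J) :
    HasDerivWithinAt (fun u => (inner ℝ (∑ i, S.ξ i (γ u)) (W u) : ℝ))
      (-((∑ i, α i (γ t)) * inner ℝ (S.f (γ t) (velocity γ J t)) (W t))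
        + (∑ i, β i (γ t)) * inner ℝ (velocity γ J t) (W t)
        + inner ℝ (∑ i, S.ξ i (γ t)) (covAlong nabla γ J W t)) J t := by
  have h := HasDerivWithinAt.fun_sum (u := Finset.univ) fun (i : Fin s) _ =>
    hasDerivWithinAt_inner_field hnabla ht ((hγ t ht).mdifferentiableWithinAt (by simp))
      (S.ξ_smooth i (γ t)) hW
  simp only [sum_inner]
  convert! h using 1
  rw [Finset.sum_add_distrib, Finset.sum_mul, Finset.sum_mul, ← Finset.sum_neg_distrib,
    ← Finset.sum_add_distrib]
  congr 1
  refine Finset.sum_congr rfl fun i _ => ?_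
  rw [hS.nabla_ξ hnabla i _ _ (hL t ht), inner_add_left, inner_neg_left, inner_smul_left,
    inner_smul_left]
  rfl

/-- Differentiating `⟨∑ ξ_i, W⟩ = 0` along the curve. -/
theorem IsTransS.inner_sum_ξ_covAlong (hS : S.IsTransS nabla α β)
    (hnabla : IsLeviCivita nabla) (hJ : UniqueDiffOn ℝ J)
    (hγ : ContMDiffOn 𝓘(ℝ, ℝ) 𝓘(ℝ, E) ∞ γ J)
    (hL : S.IsLegendre γ J) {W : ∀ t, TangentSpace 𝓘(ℝ, E) (γ t)} (hW : SmoothAlong γ J W)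
    (h0 : ∀ t ∈ J, (inner ℝ (∑ i, S.ξ i (γ t)) (W t) : ℝ) = 0) {t : ℝ} (ht : t ∈ J) :
    inner ℝ (∑ i, S.ξ i (γ t)) (covAlong nabla γ J W t) =
      (∑ i, α i (γ t)) * inner ℝ (S.f (γ t) (velocity γ J t)) (W t)
        - (∑ i, β i (γ t)) * inner ℝ (velocity γ J t) (W t) := by
  have h1 := hS.hasDerivWithinAt_inner_sum_ξ hnabla hγ hL hW ht
  have h2 : HasDerivWithinAt (fun u => (inner ℝ (∑ i, S.ξ i (γ u)) (W u) : ℝ)) 0 J t :=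
    (hasDerivWithinAt_const t J (0 : ℝ)).congr h0 (h0 t ht)
  linarith [(hJ t ht).eq_deriv _ h1 h2]

/-- Source of the smoothness of `w` and `φ`: the coordinates of `∑ ξ_i` are smooth as inner
products, although `λ` is only differentiable. -/
theorem contDiffOn_inner_sum_ξ (S : FramedMetricStructure E n s M)
    (hγ : ContMDiffOn 𝓘(ℝ, ℝ) 𝓘(ℝ, E) ∞ γ J) {W : ∀ t, TangentSpace 𝓘(ℝ, E) (γ t)}
    (hW : SmoothAlong γ J W) :
    ContDiffOn ℝ ∞ (fun u => (inner ℝ (∑ i, S.ξ i (γ u)) (W u) : ℝ)) J := by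
  simp only [sum_inner]
  refine ContDiffOn.sum fun i _ => contMDiffOn_iff_contDiffOn.1 ?_
  refine ContMDiffOn.inner_bundle (F := E) (E := fun x : M => TangentSpace 𝓘(ℝ, E) x) (b := γ)
    (fun t ht => ?_) hW
  exact ContMDiffAt.comp_contMDiffWithinAt t (S.ξ_smooth i (γ t)) (hγ t ht)

omit [IsContMDiffRiemannianBundle 𝓘(ℝ, E) ∞ E (fun x : M => TangentSpace 𝓘(ℝ, E) x)] in
theorem inner_sum_ξ_velocity (S : FramedMetricStructure E n s M) (hL : S.IsLegendre γ J) {t : ℝ}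
    (ht : t ∈ J) : (inner ℝ (∑ i, S.ξ i (γ t)) (velocity γ J t) : ℝ) = 0 := by
  rw [real_inner_comm, inner_sum]
  exact Finset.sum_eq_zero fun i _ => by rw [S.inner_ξ, hL t ht i]

/-- Differentiating `⟨∑ ξ_i, E_1⟩ = 0`. -/
theorem IsTransS.sum_β_eq (hS : S.IsTransS nabla α β)
    (hnabla : IsLeviCivita nabla) (hJ : UniqueDiffOn ℝ J)
    (hγ : IsFrenetCurve nabla γ J r F κ) (hr : 4 ≤ r) (hL : S.IsLegendre γ J) {t : ℝ}
    (ht : t ∈ J) :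
    ∑ i, β i (γ t) = -(κ 1 t * inner ℝ (∑ i, S.ξ i (γ t)) (F 2 t)) := by
  have h := hS.inner_sum_ξ_covAlong hnabla hJ hγ.smooth hL (hγ.F_smooth 1 le_rfl (by lia))
    (fun u hu => by rw [hγ.F_one u hu]; exact S.inner_sum_ξ_velocity hL hu) ht
  have h1 := hγ.frenet t ht 1 le_rfl (by lia)
  rw [if_pos rfl, if_neg (by lia), zero_add] at h1
  have h2 := hγ.orthonormal t ht 1 1 le_rfl (by lia) le_rfl (by lia)
  rw [if_pos rfl] at h2
  -- The `α`-term drops out because `fT` is orthogonal to `T`.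
  rw [h1, ← hγ.F_one t ht, S.inner_f_self, h2, inner_smul_right] at h
  linarith

/-- Differentiating `⟨∑ ξ_i, E_5⟩ = 0`. -/
theorem IsTransS.κ₄_mul_eq (hS : S.IsTransS nabla α β)
    (hnabla : IsLeviCivita nabla) (hJ : UniqueDiffOn ℝ J)
    (hγ : IsFrenetCurve nabla γ J r F κ) (hr : 5 ≤ r) (hL : S.IsLegendre γ J)
    (h0 : ∀ t ∈ J, ∀ j, 5 ≤ j → j ≤ r → (inner ℝ (∑ i, S.ξ i (γ t)) (F j t) : ℝ) = 0) {t : ℝ}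
    (ht : t ∈ J) :
    κ 4 t * inner ℝ (∑ i, S.ξ i (γ t)) (F 4 t) =
      -((∑ i, α i (γ t)) * inner ℝ (S.f (γ t) (velocity γ J t)) (F 5 t)) := by
  have h := hS.inner_sum_ξ_covAlong hnabla hJ hγ.smooth hL (hγ.F_smooth 5 (by lia) (by lia))
    (fun u hu => h0 u hu 5 le_rfl hr) ht
  have h2 := hγ.orthonormal t ht 1 5 le_rfl (by lia) (by lia) (by lia)
  rw [if_neg (by lia)] at h2
  rw [hγ.frenet t ht 5 (by lia) hr, if_neg (by lia), ← hγ.F_one t ht, h2, inner_add_right,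
    inner_neg_right, inner_smul_right, hγ.F_one t ht] at h
  -- The `E_6`-term is absent for `r = 5`, and for `r ≥ 6` it vanishes because `∑ ξ_i` is orthogonal
  -- to `E_6`.
  have h3 : (inner ℝ (∑ i, S.ξ i (γ t)) (if 5 = r then 0 else κ 5 t • F (5 + 1) t) : ℝ) = 0 := by
    split_ifs with h5
    · exact inner_zero_right _
    · rw [inner_smul_right, h0 t ht 6 (by lia) (by lia), mul_zero]
  rw [h3] at h
  norm_num at h
  linarith

omit [IsContMDiffRiemannianBundle 𝓘(ℝ, E) ∞ E (fun x : M => TangentSpace 𝓘(ℝ, E) x)] in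
-- The `E_1`-component of `ΔH` is `3κ_1κ_1'`, whereas `∑ ξ_i` is orthogonal to `E_1 = T`. As `κ_1 >
-- 0`, this forces `κ_1' = 0`.
theorem IsCProperWith.exists_κ₁_eq_const {lam : ℝ → ℝ} (h : S.IsCProperWith nabla γ J lam)
    (hJ : J.OrdConnected) (hJu : UniqueDiffOn ℝ J) (hγ : IsFrenetCurve nabla γ J r F κ)
    (hr : 4 ≤ r) (hL : S.IsLegendre γ J) : ∃ c : ℝ, ∀ t ∈ J, κ 1 t = c := by
  refine exists_eq_const_of_derivWithin_eq_zero hJ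
    ((hγ.κ_smooth 1 le_rfl (by lia)).differentiableOn (by simp)) fun t ht => ?_
  have h1 := h.eq t ht
  rw [hγ.laplacian_meanCurv hJu hr ht] at h1
  have h2 := congrArg (fun v : TangentSpace 𝓘(ℝ, E) (γ t) => (inner ℝ v (F 1 t) : ℝ)) h1
  have ho : ∀ j, 1 ≤ j → j ≤ 4 → (inner ℝ (F j t) (F 1 t) : ℝ) = if j = 1 then 1 else 0 :=
    fun j hj hj' => hγ.orthonormal t ht j 1 hj (by lia) le_rfl (by lia)
  have h3 : (inner ℝ (∑ i, S.ξ i (γ t)) (F 1 t) : ℝ) = 0 := by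
    rw [hγ.F_one t ht]; exact S.inner_sum_ξ_velocity hL ht
  simp only [inner_add_left, real_inner_smul_left, ho 1 le_rfl (by lia), ho 2 (by lia) (by lia),
    ho 3 (by lia) (by lia), ho 4 (by lia) (by lia), h3] at h2
  norm_num at h2
  exact h2.resolve_left (hγ.κ_pos 1 le_rfl (by lia) t ht).ne'

omit [IsContMDiffRiemannianBundle 𝓘(ℝ, E) ∞ E (fun x : M => TangentSpace 𝓘(ℝ, E) x)] in
theorem CProperEquations.isCProperWith {lam w φ : ℝ → ℝ}
    (h : S.CProperEquations α β γ J r F κ lam w φ) (hJ : UniqueDiffOn ℝ J)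
    (hγ : IsFrenetCurve nabla γ J r F κ) (hr : 4 ≤ r)
    (hlam : DifferentiableOn ℝ lam J) (hlam0 : ∀ t ∈ J, lam t ≠ 0) :
    S.IsCProperWith nabla γ J lam := by
  refine ⟨hlam, hlam0, fun t ht => ?_⟩
  rw [hγ.laplacian_meanCurv_of_const hJ hr h.κ₁_const ht, h.sum_ξ t ht, ← h.eq_F₂ t ht,
    ← h.eq_F₃ t ht, ← h.eq_F₄ t ht]
  module

theorem IsCProperWith.exists_cProperEquations {lam : ℝ → ℝ} (h : S.IsCProperWith nabla γ J lam)
    (hS : S.IsTransS nabla α β) (hnabla : IsLeviCivita nabla) (hJ : J.OrdConnected)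
    (hJ' : J.Nontrivial) (hγ : IsFrenetCurve nabla γ J r F κ) (hr : 4 ≤ r)
    (hL : S.IsLegendre γ J) :
    ∃ w φ : ℝ → ℝ, ContDiffOn ℝ ∞ w J ∧ ContDiffOn ℝ ∞ φ J ∧
      S.CProperEquations α β γ J r F κ lam w φ := by
  have hJu := uniqueDiffOn_of_ordConnected hJ hJ'
  have hc := h.exists_κ₁_eq_const hJ hJu hγ hr hL
  set x : ℕ → ℝ → ℝ := fun j t => inner ℝ (∑ i, S.ξ i (γ t)) (F j t) with hx
  have heq : ∀ t ∈ J, lam t • ∑ i, S.ξ i (γ t) =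
      (κ 1 t * (κ 1 t ^ 2 + κ 2 t ^ 2)) • F 2 t + (-(κ 1 t * derivWithin (κ 2) J t)) • F 3 t
      + (-(κ 1 t * κ 2 t * κ 3 t)) • F 4 t := fun t ht => by
    rw [← h.eq t ht, hγ.laplacian_meanCurv_of_const hJu hr hc ht]
  have hcomp : ∀ t ∈ J, ∀ j, 1 ≤ j → j ≤ r → lam t * x j t =
      (κ 1 t * (κ 1 t ^ 2 + κ 2 t ^ 2)) * (if 2 = j then 1 else 0)
      + (-(κ 1 t * derivWithin (κ 2) J t)) * (if 3 = j then 1 else 0)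
      + (-(κ 1 t * κ 2 t * κ 3 t)) * (if 4 = j then 1 else 0) := fun t ht j hj hj' => by
    have h1 := congrArg (fun v : TangentSpace 𝓘(ℝ, E) (γ t) => (inner ℝ v (F j t) : ℝ)) (heq t ht)
    simpa only [inner_add_left, real_inner_smul_left,
      hγ.orthonormal t ht 2 j (by lia) (by lia) hj hj',
      hγ.orthonormal t ht 3 j (by lia) (by lia) hj hj',
      hγ.orthonormal t ht 4 j (by lia) (by lia) hj hj'] using h1
  have h2 : ∀ t ∈ J, lam t * x 2 t = κ 1 t * (κ 1 t ^ 2 + κ 2 t ^ 2) := fun t ht => by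
    simpa using hcomp t ht 2 (by lia) (by lia)
  have h3 : ∀ t ∈ J, lam t * x 3 t = -(κ 1 t * derivWithin (κ 2) J t) := fun t ht => by
    simpa using hcomp t ht 3 (by lia) (by lia)
  have h4 : ∀ t ∈ J, lam t * x 4 t = -(κ 1 t * κ 2 t * κ 3 t) := fun t ht => by
    simpa using hcomp t ht 4 (by lia) (by lia)
  have h5 : ∀ t ∈ J, ∀ j, 5 ≤ j → j ≤ r → x j t = 0 := fun t ht j hj hj' => by
    have := hcomp t ht j (by lia) hj'
    rw [if_neg (by lia), if_neg (by lia), if_neg (by lia)] at this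
    exact (mul_eq_zero.1 (this.trans (by ring))).resolve_left (h.ne_zero t ht)
  have hexp : ∀ t ∈ J, ∑ i, S.ξ i (γ t) = x 2 t • F 2 t + x 3 t • F 3 t + x 4 t • F 4 t :=
    fun t ht => by
      have h1 := heq t ht
      rw [← h2 t ht, ← h3 t ht, ← h4 t ht] at h1
      refine smul_right_injective _ (h.ne_zero t ht) (h1.trans ?_)
      module
  have hsq : ∀ t ∈ J, x 2 t ^ 2 + x 3 t ^ 2 + x 4 t ^ 2 = s := fun t ht => by
    have h1 := S.inner_sum_ξ_self (γ t)
    -- Expanding only one factor leaves the products `⟨∑ ξ_i, E_j⟩ = x j` in place, so the squares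
    -- appear without orthonormality.
    nth_rewrite 2 [hexp t ht] at h1
    simp only [inner_add_right, inner_smul_right] at h1
    rw [← h1]
    ring
  -- Positivity of `κ_1, κ_2, κ_3` enters here. It also yields `s > 0` below, hence division by
  -- `√s`, and later the division in the formula for `κ_4`.
  have hx4 : ∀ t ∈ J, x 4 t ≠ 0 := fun t ht h0 => by
    have h1 := h4 t ht
    rw [h0, mul_zero, eq_comm, neg_eq_zero] at h1
    have := hγ.κ_pos 1 le_rfl (by lia) t ht
    have := hγ.κ_pos 2 (by lia) (by lia) t ht
    have := hγ.κ_pos 3 (by lia) (by lia) t ht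
    exact (by positivity : κ 1 t * κ 2 t * κ 3 t ≠ 0) h1
  obtain ⟨t₀, ht₀⟩ := hJ'.nonempty
  have hs : 0 < (s : ℝ) := by
    have := hx4 t₀ ht₀
    rw [← hsq t₀ ht₀]
    positivity
  have hs0 : √(s : ℝ) ≠ 0 := (Real.sqrt_pos.2 hs).ne'
  have hss : √(s : ℝ) ^ 2 = s := Real.sq_sqrt hs.le
  have hxs : ∀ j, 1 ≤ j → j ≤ 4 → ContDiffOn ℝ ∞ (fun t => x j t / √(s : ℝ)) J :=
    fun j hj hj' => (S.contDiffOn_inner_sum_ξ hγ.smooth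
      (hγ.F_smooth j hj (by lia))).div_const _
  obtain ⟨w, φ, hw, hφ, hwφ⟩ := exists_spherical_coordinates hJ (hxs 2 (by lia) (by lia))
    (hxs 3 (by lia) (by lia)) (hxs 4 (by lia) (by lia))
    (fun t ht => by rw [div_pow, div_pow, div_pow, hss, ← add_div, ← add_div, hsq t ht,
      div_self hs.ne']) (fun t ht => div_ne_zero (hx4 t ht) hs0)
  have e2 : ∀ t ∈ J, √(s : ℝ) * Real.cos (w t) = x 2 t := fun t ht => by
    rw [(hwφ t ht).1, mul_div_cancel₀ _ hs0]
  have e3 : ∀ t ∈ J, √(s : ℝ) * (Real.sin (w t) * Real.cos (φ t)) = x 3 t := fun t ht => by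
    rw [(hwφ t ht).2.1, mul_div_cancel₀ _ hs0]
  have e4 : ∀ t ∈ J, √(s : ℝ) * (Real.sin (w t) * Real.sin (φ t)) = x 4 t := fun t ht => by
    rw [(hwφ t ht).2.2, mul_div_cancel₀ _ hs0]
  refine ⟨w, φ, hw, hφ, ⟨fun t ht => ?_, hc, fun t ht => ?_, fun t ht => ?_, fun t ht => ?_,
    fun t ht => ?_, fun hr5 t ht => ?_⟩⟩
  · rw [smul_add, smul_add, smul_smul, smul_smul, smul_smul, e2 t ht, e3 t ht, e4 t ht]
    exact hexp t ht
  · rw [hS.sum_β_eq hnabla hJu hγ hr hL ht, mul_right_comm, e2 t ht, mul_comm]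
  · rw [mul_assoc, e2 t ht, h2 t ht]
  · rw [mul_assoc, e3 t ht, h3 t ht]
  · rw [mul_assoc, e4 t ht, h4 t ht]
  · rw [e4 t ht, eq_div_iff (hx4 t ht)]
    exact hS.κ₄_mul_eq hnabla hJu hγ hr5 hL h5 ht

end FramedMetricStructure

end CProperCurves

end TransS

theorem mainTheorem7 {n s : ℕ} {E : Type*} [NormedAddCommGroup E] [NormedSpace ℝ E]
    [FiniteDimensional ℝ E] (M : Type*) [TopologicalSpace M] [T2Space M]
    [ChartedSpace E M] [IsManifold 𝓘(ℝ, E) ∞ M]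
    [RiemannianBundle (fun x : M => TangentSpace 𝓘(ℝ, E) x)]
    [IsContMDiffRiemannianBundle 𝓘(ℝ, E) ∞ E (fun x : M => TangentSpace 𝓘(ℝ, E) x)]
    (nabla : CovariantDerivative 𝓘(ℝ, E) E (fun x : M => TangentSpace 𝓘(ℝ, E) x))
    (hnabla : TransS.IsLeviCivita nabla)
    (S : TransS.FramedMetricStructure E n s M) (α β : Fin s → M → ℝ)
    (hS : S.IsTransS nabla α β)
    (J : Set ℝ) (hJ : J.OrdConnected) (hJ' : J.Nontrivial)
    (γ : ℝ → M) (r : ℕ) (hr : 4 ≤ r)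
    (F : ℕ → ∀ t, TangentSpace 𝓘(ℝ, E) (γ t)) (κ : ℕ → ℝ → ℝ)
    (hγ : TransS.IsFrenetCurve nabla γ J r F κ) (hL : S.IsLegendre γ J) :
    (S.IsCProper nabla γ J ↔
      ∃ lam w φ : ℝ → ℝ, DifferentiableOn ℝ lam J ∧ (∀ t ∈ J, lam t ≠ 0) ∧
        ContDiffOn ℝ ∞ w J ∧ ContDiffOn ℝ ∞ φ J ∧
        S.CProperEquations α β γ J r F κ lam w φ) ∧
    ∀ lam : ℝ → ℝ, DifferentiableOn ℝ lam J → (∀ t ∈ J, lam t ≠ 0) →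
      (S.IsCProperWith nabla γ J lam ↔
        ∃ w φ : ℝ → ℝ, ContDiffOn ℝ ∞ w J ∧ ContDiffOn ℝ ∞ φ J ∧
          S.CProperEquations α β γ J r F κ lam w φ) := by

  -- The equivalence for a fixed factor; the existential one follows by quantifying over `lam`.
  have key : ∀ lam : ℝ → ℝ, DifferentiableOn ℝ lam J → (∀ t ∈ J, lam t ≠ 0) →
      (S.IsCProperWith nabla γ J lam ↔
        ∃ w φ : ℝ → ℝ, ContDiffOn ℝ ∞ w J ∧ ContDiffOn ℝ ∞ φ J ∧
          S.CProperEquations α β γ J r F κ lam w φ) := fun lam hd h0 =>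
    ⟨fun h => h.exists_cProperEquations hS hnabla hJ hJ' hγ hr hL,
      fun ⟨_, _, _, _, h⟩ =>
        h.isCProperWith (TransS.uniqueDiffOn_of_ordConnected hJ hJ') hγ hr hd h0⟩
  refine ⟨⟨fun ⟨lam, h⟩ => ?_, fun ⟨lam, w, φ, hd, h0, hw, hφ, h⟩ => ?_⟩, key⟩
  · obtain ⟨w, φ, hw, hφ, h'⟩ := (key lam h.diff h.ne_zero).1 h
    exact ⟨lam, w, φ, h.diff, h.ne_zero, hw, hφ, h'⟩
  · exact ⟨lam, (key lam hd h0).2 ⟨w, φ, hw, hφ, h⟩⟩
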